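/- Let $\mathcal C$ be a small category. A representation $R:\mathcal C\to\mathrm{Add}$ is a pseudofunctor to small preadditive categories: it consists of small preadditive categories $R_c$ ($c\in\mathrm{Ob}\,\mathcal C$), additive functors $R_\alpha:R_c\to R_d$ ($\alpha:c\to d$), and natural isomorphisms $\delta_c:\mathrm{id}_{R_c}\cong R_{\mathrm{id}_c}$ and $\mu_{\beta,\alpha}:R_\beta R_\alpha\cong R_{\beta\alpha}$ satisfying the usual associativity and unit coherence axioms. For a small preadditive category $A$, let $(A^{op},\mathrm{Ab})$ be the category of additive functors $A^{op}\to\mathrm{Ab}$. For $\alpha:c\to d$, let $\alpha^*:(R_d^{op},\mathrm{Ab})\to(R_c^{op},\mathrm{Ab})$, $N\mapsto N\circ R_\alpha$, be restriction of scalars, and let $\alpha_!=-\otimes_{R_c}\mathrm{Hom}_{R_d}(-,R_\alpha(-))$ be extension of scalars, its left adjoint. The representation $R$ is right flat if $\alpha_!$ is exact for every morphism $\alpha$ of $\mathcal C$. A right $R$-module $M$ consists of objects $M_c\in(R_c^{op},\mathrm{Ab})$ ($c\in\mathrm{Ob}\,\mathcal C$) and morphisms $M_\alpha:M_c\to\alpha^*(M_d)$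 ($\alpha:c\to d$) such that, for all $\alpha:c\to d$ and $\beta:d\to e$, $\alpha^*(M_\beta)\circ M_\alpha$ equals $M_{\beta\alpha}$ followed by the map $(\beta\alpha)^*M_e\to\alpha^*\beta^*M_e$ induced by $\mu_{\beta,\alpha}$, and, for all $c$, $M_{\mathrm{id}_c}$ followed by the map $(\mathrm{id}_c)^*M_c\to M_c$ induced by $\delta_c$ is the identity. A morphism $M\to N$ is a family of morphisms $\phi_c:M_c\to N_c$ with $\alpha^*(\phi_d)\circ M_\alpha=N_\alpha\circ\phi_c$ for all $\alpha:c\to d$. The module $M$ is cartesian if for every $\alpha:c\to d$ the morphism $\alpha_!(M_c)\to M_d$ adjoint to $M_\alpha$ is an isomorphism. **Theorem.** If $R$ is a right flat representation of a small category $\mathcal C$, then the category $\mathrm{Mod}_{\mathrm{cart}}(R)$ of cartesian right $R$-modules (a full subcategory of the category of right $R$-modules) is a Grothendieck category, i.e. an abelian category with (small) filtered colimits, in which these are exact, and with a generator. -/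

import Mathlib

open CategoryTheory CategoryTheory.Limits Opposite
open scoped TensorProduct DirectSum

universe u

noncomputable section

namespace CartesianModules

/-! ### Modules over a small preadditive category -/

/-- The category `(Rᵒᵖ, Ab)` of right modules over a small preadditive category `R`:
additive functors `Rᵒᵖ ⥤ Ab` and natural transformations. -/
abbrev RightMod (R : Type u) [Category.{u} R] [Preadditive R] : Type (u + 1) :=
  Rᵒᵖ ⥤+ AddCommGrpCat.{u}

/-- The category `(R, Ab)` of left modules over a small preadditive category `R`. -/
abbrev LeftMod (R : Type u) [Category.{u} R] [Preadditive R] : Type (u + 1) :=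
  R ⥤+ AddCommGrpCat.{u}

section Tensor

variable {R : Type u} [Category.{u} R] [Preadditive R]

/-- The direct sum over all objects `a` of `R` of the groups `M(a) ⊗_ℤ N(a)`. -/
abbrev TensorSum (M : RightMod R) (N : LeftMod R) : Type u :=
  ⨁ a : R, ((M.obj.obj (op a) : Type u) ⊗[ℤ] (N.obj.obj a : Type u))

open scoped Classical in
/-- The element `x ⊗ y` of the summand of index `a`. -/
def TensorSum.pure (M : RightMod R) (N : LeftMod R) (a : R)
    (x : M.obj.obj (op a)) (y : N.obj.obj a) : TensorSum M N :=
  DirectSum.of (fun a : R => (M.obj.obj (op a) : Type u) ⊗[ℤ] (N.obj.obj a : Type u)) a (x ⊗ₜ[ℤ] y)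

/-- The subgroup generated by the elements `M(r)(x) ⊗ y - x ⊗ N(r)(y)`, for
`r : a ⟶ b` in `R`, `x ∈ M(b)` and `y ∈ N(a)`. -/
def tensorRel (M : RightMod R) (N : LeftMod R) : AddSubgroup (TensorSum M N) :=
  AddSubgroup.closure
    {t | ∃ (a b : R) (r : a ⟶ b) (x : M.obj.obj (op b)) (y : N.obj.obj a),
      t = TensorSum.pure M N a (M.obj.map r.op x) y - TensorSum.pure M N b x (N.obj.map r y)}

/-- The tensor product `M ⊗_R N` of a right and a left module over `R`. -/
def Tensor (M : RightMod R) (N : LeftMod R) : Type u :=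
  TensorSum M N ⧸ tensorRel M N

instance (M : RightMod R) (N : LeftMod R) : AddCommGroup (Tensor M N) :=
  inferInstanceAs (AddCommGroup (TensorSum M N ⧸ tensorRel M N))

namespace Tensor

variable {M M' M'' : RightMod R} {N N' N'' : LeftMod R}

/-- The class of `x ⊗ y`, where `x ∈ M(a)` and `y ∈ N(a)`. -/
def tmul (a : R) (x : M.obj.obj (op a)) (y : N.obj.obj a) : Tensor M N :=
  QuotientAddGroup.mk (TensorSum.pure M N a x y)

theorem tmul_add (a : R) (x : M.obj.obj (op a)) (y y' : N.obj.obj a) :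
    (tmul a x (y + y') : Tensor M N) = tmul a x y + tmul a x y' := by
  change QuotientAddGroup.mk _ = QuotientAddGroup.mk (_ + _)
  simp only [TensorSum.pure, TensorProduct.tmul_add, map_add]

theorem add_tmul (a : R) (x x' : M.obj.obj (op a)) (y : N.obj.obj a) :
    (tmul a (x + x') y : Tensor M N) = tmul a x y + tmul a x' y := by
  change QuotientAddGroup.mk _ = QuotientAddGroup.mk (_ + _)
  simp only [TensorSum.pure, TensorProduct.add_tmul, map_add]

theorem map_tmul {a b : R} (r : a ⟶ b) (x : M.obj.obj (op b)) (y : N.obj.obj a) :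
    (tmul a (M.obj.map r.op x) y : Tensor M N) = tmul b x (N.obj.map r y) := by
  refine QuotientAddGroup.eq_iff_sub_mem.2 (AddSubgroup.subset_closure ?_)
  exact ⟨a, b, r, x, y, rfl⟩

/-- The homomorphism `M(a) ⊗_ℤ N(a) → A` given by a biadditive map. -/
def liftSummand {A : Type u} [AddCommGroup A] (a : R)
    (f : M.obj.obj (op a) →+ N.obj.obj a →+ A) :
    (M.obj.obj (op a) : Type u) ⊗[ℤ] (N.obj.obj a : Type u) →+ A :=
  TensorProduct.liftAddHom f fun n x y => by
    simp only [map_zsmul, AddMonoidHom.coe_smul, Pi.smul_apply]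

open scoped Classical in
/-- The homomorphism `⨁ M(a) ⊗_ℤ N(a) → A` given by a family of biadditive maps. -/
def liftSum {A : Type u} [AddCommGroup A]
    (f : ∀ a : R, M.obj.obj (op a) →+ N.obj.obj a →+ A) : TensorSum M N →+ A :=
  DirectSum.toAddMonoid fun a => liftSummand a (f a)

theorem liftSum_pure {A : Type u} [AddCommGroup A]
    (f : ∀ a : R, M.obj.obj (op a) →+ N.obj.obj a →+ A)
    (a : R) (x : M.obj.obj (op a)) (y : N.obj.obj a) :
    liftSum f (TensorSum.pure M N a x y) = f a x y := by
  classical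
  unfold liftSum TensorSum.pure
  rw [DirectSum.toAddMonoid_of]
  rfl

/-- The universal property of the tensor product: families of biadditive maps
`M(a) × N(a) → A` that are balanced over `R` extend to `M ⊗_R N`. -/
def lift {A : Type u} [AddCommGroup A]
    (f : ∀ a : R, M.obj.obj (op a) →+ N.obj.obj a →+ A)
    (hf : ∀ {a b : R} (r : a ⟶ b) (x : M.obj.obj (op b)) (y : N.obj.obj a),
      f a (M.obj.map r.op x) y = f b x (N.obj.map r y)) : Tensor M N →+ A :=
  QuotientAddGroup.lift (tensorRel M N) (liftSum f) (by
    rw [tensorRel, AddSubgroup.closure_le]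
    rintro _ ⟨a, b, r, x, y, rfl⟩
    rw [SetLike.mem_coe, AddMonoidHom.mem_ker, map_sub, liftSum_pure, liftSum_pure, hf, sub_self])

@[simp]
theorem lift_tmul {A : Type u} [AddCommGroup A]
    (f : ∀ a : R, M.obj.obj (op a) →+ N.obj.obj a →+ A)
    (hf : ∀ {a b : R} (r : a ⟶ b) (x : M.obj.obj (op b)) (y : N.obj.obj a),
      f a (M.obj.map r.op x) y = f b x (N.obj.map r y))
    (a : R) (x : M.obj.obj (op a)) (y : N.obj.obj a) :
    lift f hf (tmul a x y) = f a x y := by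
  classical
  exact liftSum_pure f a x y

/-- Homomorphisms out of `M ⊗_R N` are determined by the elements `x ⊗ y`. -/
theorem addHom_ext {A : Type u} [AddCommGroup A] {f g : Tensor M N →+ A}
    (h : ∀ (a : R) (x : M.obj.obj (op a)) (y : N.obj.obj a), f (tmul a x y) = g (tmul a x y)) :
    f = g := by
  classical
  refine QuotientAddGroup.addMonoidHom_ext _ (DirectSum.addHom_ext' fun a => ?_)
  ext t
  induction t using TensorProduct.induction_on with
  | zero => simp only [_root_.map_zero]
  | add s t hs ht => simp only [_root_.map_add, hs, ht]
  | tmul x y => exact h a x y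

/-- The biadditive map `(x, y) ↦ φ(x) ⊗ ψ(y)`. -/
def mapAux (φ : M ⟶ M') (ψ : N ⟶ N') (a : R) :
    M.obj.obj (op a) →+ N.obj.obj a →+ Tensor M' N' :=
  AddMonoidHom.mk'
    (fun x => AddMonoidHom.mk' (fun y => tmul a (φ.hom.app (op a) x) (ψ.hom.app a y))
      (fun y y' => by rw [_root_.map_add, tmul_add]))
    (fun x x' => by ext y; simp [add_tmul])

theorem mapAux_balanced (φ : M ⟶ M') (ψ : N ⟶ N') {a b : R} (r : a ⟶ b)
    (x : M.obj.obj (op b)) (y : N.obj.obj a) :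
    mapAux φ ψ a (M.obj.map r.op x) y = mapAux φ ψ b x (N.obj.map r y) := by
  have h₁ : φ.hom.app (op a) (M.obj.map r.op x) = M'.obj.map r.op (φ.hom.app (op b) x) :=
    NatTrans.naturality_apply φ.hom r.op x
  have h₂ : ψ.hom.app b (N.obj.map r y) = N'.obj.map r (ψ.hom.app a y) :=
    NatTrans.naturality_apply ψ.hom r y
  simp only [mapAux, AddMonoidHom.mk'_apply]
  rw [h₁, h₂, map_tmul]

/-- The homomorphism `φ ⊗_R ψ : M ⊗_R N → M' ⊗_R N'`, `x ⊗ y ↦ φ(x) ⊗ ψ(y)`. -/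
def map (φ : M ⟶ M') (ψ : N ⟶ N') : Tensor M N →+ Tensor M' N' :=
  lift (mapAux φ ψ) (mapAux_balanced φ ψ)

@[simp]
theorem map_tmul_tmul (φ : M ⟶ M') (ψ : N ⟶ N') (a : R) (x : M.obj.obj (op a))
    (y : N.obj.obj a) :
    map φ ψ (tmul a x y) = tmul a (φ.hom.app (op a) x) (ψ.hom.app a y) :=
  lift_tmul (mapAux φ ψ) (mapAux_balanced φ ψ) a x y

theorem map_id : map (𝟙 M) (𝟙 N) = AddMonoidHom.id (Tensor M N) :=
  addHom_ext fun a x y => by simp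

theorem map_comp (φ : M ⟶ M') (φ' : M' ⟶ M'') (ψ : N ⟶ N') (ψ' : N' ⟶ N'') :
    map (φ ≫ φ') (ψ ≫ ψ') = (map φ' ψ').comp (map φ ψ) :=
  addHom_ext fun a x y => by simp

end Tensor
end Tensor

/-! ### Change of base -/

section ChangeOfBase

variable {R S : Type u} [Category.{u} R] [Preadditive R] [Category.{u} S] [Preadditive S]
variable (φ : R ⥤ S) [φ.Additive]

/-- Restriction of scalars `φ^* : (Sᵒᵖ, Ab) ⥤ (Rᵒᵖ, Ab)`, `N ↦ N ∘ φ`. -/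
def restrictScalars : RightMod S ⥤ RightMod R where
  obj N := AdditiveFunctor.of (φ.op ⋙ N.obj)
  map f := ObjectProperty.homMk (Functor.whiskerLeft φ.op f.hom)

/-- For an object `b` of `S`, the left `R`-module `Hom_S(b, φ(-))`. -/
def homModule (b : S) : LeftMod R :=
  AdditiveFunctor.of (φ ⋙ preadditiveCoyoneda.obj (op b))

/-- The morphism `Hom_S(b, φ(-)) ⟶ Hom_S(b', φ(-))` of precomposition with `g : b' ⟶ b`. -/
def homModuleMap {b b' : S} (g : b' ⟶ b) : homModule φ b ⟶ homModule φ b' :=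
  ObjectProperty.homMk (Functor.whiskerLeft φ (preadditiveCoyoneda.map g.op))

theorem homModuleMap_id (b : S) : homModuleMap φ (𝟙 b) = 𝟙 (homModule φ b) := by
  rw [homModuleMap, op_id, CategoryTheory.Functor.map_id]
  rfl

theorem homModuleMap_comp {b b' b'' : S} (g : b' ⟶ b) (g' : b'' ⟶ b') :
    homModuleMap φ (g' ≫ g) = homModuleMap φ g ≫ homModuleMap φ g' := by
  rw [homModuleMap, op_comp, CategoryTheory.Functor.map_comp]
  rfl

/-- The right `S`-module `φ_!(M) = M ⊗_R Hom_S(-, φ(-))`. -/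
def extendObj (M : RightMod R) : Sᵒᵖ ⥤ AddCommGrpCat.{u} where
  obj b := AddCommGrpCat.of (Tensor M (homModule φ b.unop))
  map g := AddCommGrpCat.ofHom (Tensor.map (𝟙 M) (homModuleMap φ g.unop))
  map_id b := by
    rw [unop_id, homModuleMap_id, Tensor.map_id]
    rfl
  map_comp g g' := by
    rw [unop_comp, homModuleMap_comp, ← Category.comp_id (𝟙 M), Tensor.map_comp,
      Category.comp_id, AddCommGrpCat.ofHom_comp]

/-- The element `x ⊗ f` of `φ_!(M)(b)`, for `x ∈ M(a)` and `f : b ⟶ φ(a)`. -/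
def etmul {M : RightMod R} {a : R} {b : Sᵒᵖ} (x : M.obj.obj (op a)) (f : b.unop ⟶ φ.obj a) :
    (extendObj φ M).obj b :=
  Tensor.tmul (N := homModule φ b.unop) a x f

variable {φ}

theorem etmul_add {M : RightMod R} {a : R} {b : Sᵒᵖ} (x : M.obj.obj (op a))
    (f g : b.unop ⟶ φ.obj a) : etmul φ x (f + g) = etmul φ x f + etmul φ x g :=
  Tensor.tmul_add (N := homModule φ b.unop) a x f g

theorem add_etmul {M : RightMod R} {a : R} {b : Sᵒᵖ} (x y : M.obj.obj (op a))
    (f : b.unop ⟶ φ.obj a) : etmul φ (x + y) f = etmul φ x f + etmul φ y f :=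
  Tensor.add_tmul (N := homModule φ b.unop) a x y f

theorem map_etmul {M : RightMod R} {a a' : R} {b : Sᵒᵖ} (r : a ⟶ a') (x : M.obj.obj (op a'))
    (f : b.unop ⟶ φ.obj a) : etmul φ (M.obj.map r.op x) f = etmul φ x (f ≫ φ.map r) :=
  Tensor.map_tmul (N := homModule φ b.unop) r x f

theorem extendObj_map_etmul {M : RightMod R} {a : R} {b b' : Sᵒᵖ} (g : b ⟶ b')
    (x : M.obj.obj (op a)) (f : b.unop ⟶ φ.obj a) :
    (extendObj φ M).map g (etmul φ x f) = etmul φ x (g.unop ≫ f) :=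
  Tensor.map_tmul_tmul (N := homModule φ b.unop) (𝟙 M) (homModuleMap φ g.unop) a x f

theorem extendObj_hom_ext {M : RightMod R} {b : Sᵒᵖ} {A : AddCommGrpCat.{u}}
    {h k : (extendObj φ M).obj b ⟶ A}
    (w : ∀ (a : R) (x : M.obj.obj (op a)) (f : b.unop ⟶ φ.obj a),
      h (etmul φ x f) = k (etmul φ x f)) : h = k :=
  AddCommGrpCat.hom_ext (Tensor.addHom_ext (N := homModule φ b.unop) w)

/-- Homomorphisms out of `φ_!(M)(b)` from balanced biadditive maps. -/
def extendDesc {M : RightMod R} {b : Sᵒᵖ} {A : AddCommGrpCat.{u}}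
    (h : ∀ a : R, M.obj.obj (op a) →+ (b.unop ⟶ φ.obj a) →+ A)
    (hh : ∀ {a a' : R} (r : a ⟶ a') (x : M.obj.obj (op a')) (f : b.unop ⟶ φ.obj a),
      h a (M.obj.map r.op x) f = h a' x (f ≫ φ.map r)) : (extendObj φ M).obj b ⟶ A :=
  AddCommGrpCat.ofHom (Tensor.lift (N := homModule φ b.unop) h hh)

theorem extendDesc_etmul {M : RightMod R} {b : Sᵒᵖ} {A : AddCommGrpCat.{u}}
    (h : ∀ a : R, M.obj.obj (op a) →+ (b.unop ⟶ φ.obj a) →+ A)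
    (hh : ∀ {a a' : R} (r : a ⟶ a') (x : M.obj.obj (op a')) (f : b.unop ⟶ φ.obj a),
      h a (M.obj.map r.op x) f = h a' x (f ≫ φ.map r))
    (a : R) (x : M.obj.obj (op a)) (f : b.unop ⟶ φ.obj a) :
    extendDesc h hh (etmul φ x f) = h a x f :=
  Tensor.lift_tmul (N := homModule φ b.unop) h hh a x f

instance (M : RightMod R) : (extendObj φ M).Additive where
  map_add {b b' g g'} := extendObj_hom_ext fun a x f => by
    rw [extendObj_map_etmul, unop_add, Preadditive.add_comp, etmul_add]
    change _ = (extendObj φ M).map g _ + (extendObj φ M).map g' _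
    rw [extendObj_map_etmul, extendObj_map_etmul]

variable (φ)

/-- Extension of scalars `φ_! = - ⊗_R Hom_S(-, φ(-)) : (Rᵒᵖ, Ab) ⥤ (Sᵒᵖ, Ab)`. -/
def extendScalars : RightMod R ⥤ RightMod S where
  obj M := AdditiveFunctor.of (extendObj φ M)
  map f := ObjectProperty.homMk
    { app := fun b => AddCommGrpCat.ofHom (Tensor.map f (𝟙 (homModule φ b.unop)))
      naturality := fun b b' g => by
        change AddCommGrpCat.ofHom _ ≫ AddCommGrpCat.ofHom _ =
          AddCommGrpCat.ofHom _ ≫ AddCommGrpCat.ofHom _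
        rw [← AddCommGrpCat.ofHom_comp, ← AddCommGrpCat.ofHom_comp, ← Tensor.map_comp,
          ← Tensor.map_comp]
        simp only [Category.id_comp, Category.comp_id] }
  map_id M := by
    ext b : 3
    exact congrArg AddCommGrpCat.ofHom Tensor.map_id
  map_comp f g := by
    ext b : 3
    change AddCommGrpCat.ofHom _ = AddCommGrpCat.ofHom _ ≫ AddCommGrpCat.ofHom _
    rw [← AddCommGrpCat.ofHom_comp, ← Tensor.map_comp, Category.comp_id]

variable {φ}

theorem extendScalars_map_etmul {M M' : RightMod R} (h : M ⟶ M') {a : R} {b : Sᵒᵖ}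
    (x : M.obj.obj (op a)) (f : b.unop ⟶ φ.obj a) :
    ((extendScalars φ).map h).hom.app b (etmul φ x f) = etmul φ (h.hom.app (op a) x) f :=
  Tensor.map_tmul_tmul (N := homModule φ b.unop) h (𝟙 _) a x f

variable (φ)

/-- The unit `M ⟶ φ^* φ_! M`, `x ∈ M(a) ↦ x ⊗ id_{φ(a)}`. -/
def unitApp (M : RightMod R) : M ⟶ (restrictScalars φ).obj ((extendScalars φ).obj M) :=
  ObjectProperty.homMk
    { app := fun a => AddCommGrpCat.ofHom (AddMonoidHom.mk'
        (fun x => (etmul φ (a := a.unop) (b := op (φ.obj a.unop)) x (𝟙 _) :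
          (extendObj φ M).obj (op (φ.obj a.unop))))
        (fun x y => add_etmul x y _))
      naturality := fun a a' r => by
        ext x
        change etmul φ (a := a'.unop) (b := op (φ.obj a'.unop)) (M.obj.map r x) (𝟙 _) =
          (extendObj φ M).map (φ.map r.unop).op
            (etmul φ (a := a.unop) (b := op (φ.obj a.unop)) x (𝟙 _))
        rw [extendObj_map_etmul]
        refine (map_etmul (φ := φ) r.unop x (𝟙 _)).trans ?_
        congr 1
        simp }

/-- The biadditive map `N(c) × Hom_S(b, c) → N(b)`, `(n, f) ↦ N(f)(n)`. -/
def actHom (N : RightMod S) (c b : S) :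
    N.obj.obj (op c) →+ (b ⟶ c) →+ N.obj.obj (op b) :=
  AddMonoidHom.mk'
    (fun x => AddMonoidHom.mk' (fun f => N.obj.map f.op x)
      (fun f g => by rw [op_add, Functor.map_add]; rfl))
    (fun x x' => by
      ext f
      exact _root_.map_add (N.obj.map f.op).hom x x')

theorem actHom_balanced (N : RightMod S) (b : S) {a a' : R} (r : a ⟶ a')
    (x : N.obj.obj (op (φ.obj a'))) (f : b ⟶ φ.obj a) :
    actHom N (φ.obj a) b (((restrictScalars φ).obj N).obj.map r.op x) f =
      actHom N (φ.obj a') b x (f ≫ φ.map r) := by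
  change N.obj.map f.op (N.obj.map (φ.map r).op x) = N.obj.map (f ≫ φ.map r).op x
  rw [op_comp, Functor.map_comp]
  rfl

/-- The component `φ_! φ^* N (b) ⟶ N(b)` of the counit. -/
def counitAppApp (N : RightMod S) (b : Sᵒᵖ) :
    (extendObj φ ((restrictScalars φ).obj N)).obj b ⟶ N.obj.obj b :=
  extendDesc (fun a => actHom N (φ.obj a) b.unop) (actHom_balanced φ N b.unop)

theorem counitAppApp_etmul (N : RightMod S) (b : Sᵒᵖ) (a : R)
    (x : N.obj.obj (op (φ.obj a))) (f : b.unop ⟶ φ.obj a) :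
    counitAppApp φ N b (etmul φ (M := (restrictScalars φ).obj N) x f) = N.obj.map f.op x :=
  extendDesc_etmul (M := (restrictScalars φ).obj N) (fun a => actHom N (φ.obj a) b.unop)
    (actHom_balanced φ N b.unop) a x f

/-- The counit `φ_! φ^* N ⟶ N`, `n ⊗ f ↦ N(f)(n)` for `n ∈ N(φ(a))` and `f : b ⟶ φ(a)`. -/
def counitApp (N : RightMod S) : (extendScalars φ).obj ((restrictScalars φ).obj N) ⟶ N :=
  ObjectProperty.homMk
    { app := fun b => counitAppApp φ N b
      naturality := fun b b' g => by
        refine extendObj_hom_ext fun a x f => ?_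
        change counitAppApp φ N b' ((extendObj φ _).map g _) = N.obj.map g (counitAppApp φ N b _)
        rw [extendObj_map_etmul]
        refine (counitAppApp_etmul φ N b' a x (g.unop ≫ f)).trans ?_
        refine Eq.trans ?_ (congrArg (N.obj.map g) (counitAppApp_etmul φ N b a x f)).symm
        rw [op_comp, Functor.map_comp]
        rfl }

/-- The change of base adjunction `φ_! ⊣ φ^*`. -/
def changeOfBase : extendScalars φ ⊣ restrictScalars φ where
  unit :=
    { app := unitApp φ
      naturality := fun M M' h => by
        ext a x
        exact (extendScalars_map_etmul (φ := φ) h (a := a.unop) (b := op (φ.obj a.unop))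
          x (𝟙 _)).symm }
  counit :=
    { app := counitApp φ
      naturality := fun N N' h => by
        ext b : 3
        refine extendObj_hom_ext fun a x f => ?_
        change counitAppApp φ N' b (((extendScalars φ).map _).hom.app b _) =
          h.hom.app b (counitAppApp φ N b _)
        rw [extendScalars_map_etmul]
        refine (counitAppApp_etmul φ N' b a (h.hom.app (op (φ.obj a)) x) f).trans ?_
        refine Eq.trans ?_ (congrArg (h.hom.app b) (counitAppApp_etmul φ N b a x f)).symm
        exact (NatTrans.naturality_apply h.hom f.op x).symm }
  left_triangle_components M := by
    ext b : 3
    refine extendObj_hom_ext fun a x f => ?_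
    change counitAppApp φ ((extendScalars φ).obj M) b
      (((extendScalars φ).map (unitApp φ M)).hom.app b (etmul φ x f)) = etmul φ x f
    rw [extendScalars_map_etmul]
    refine (counitAppApp_etmul φ _ b a _ f).trans ?_
    refine (extendObj_map_etmul (b := op (φ.obj a)) f.op x (𝟙 _)).trans ?_
    exact congrArg (etmul φ x) (Category.comp_id f)
  right_triangle_components N := by
    ext a x
    refine (counitAppApp_etmul φ N (op (φ.obj a.unop)) a.unop x (𝟙 _)).trans ?_
    rw [op_id, CategoryTheory.Functor.map_id]
    rfl

/-- `φ` is right flat if `φ_!` is an exact functor. -/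
def IsRightFlat : Prop :=
  exactFunctor (RightMod R) (RightMod S) (extendScalars φ)

end ChangeOfBase

/-! ### Representations of a small category and their modules -/

section Representation

variable (C : Type u) [SmallCategory C]

/-- A representation of a small category `C`: a pseudofunctor from `C` to the 2-category of small
preadditive categories, additive functors and natural transformations. -/
structure Representation where
  /-- The preadditive category `R_c`. -/
  obj : C → Type u
  [category : ∀ c, SmallCategory (obj c)]
  [preadditive : ∀ c, Preadditive (obj c)]
  /-- The functor `R_α : R_c ⥤ R_d`. -/
  map : ∀ {c d : C}, (c ⟶ d) → obj c ⥤ obj d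
  [additive : ∀ {c d : C} (α : c ⟶ d), (map α).Additive]
  /-- The isomorphism `δ_c : id ≅ R_{id_c}`. -/
  δ : ∀ c : C, 𝟭 (obj c) ≅ map (𝟙 c)
  /-- The isomorphism `μ_{β,α} : R_β R_α ≅ R_{βα}`. -/
  μ : ∀ {c d e : C} (α : c ⟶ d) (β : d ⟶ e), map α ⋙ map β ≅ map (α ≫ β)
  /-- `μ_{γ,βα} ∘ R_γ(μ_{β,α}) = μ_{γβ,α} ∘ μ_{γ,β}`, up to the equality `(γβ)α = γ(βα)`. -/
  assoc : ∀ {c d e f : C} (α : c ⟶ d) (β : d ⟶ e) (γ : e ⟶ f) (a : obj c),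
    (map γ).map ((μ α β).hom.app a) ≫ (μ (α ≫ β) γ).hom.app a =
      (μ β γ).hom.app ((map α).obj a) ≫ (μ α (β ≫ γ)).hom.app a ≫
        eqToHom (by rw [Category.assoc])
  /-- `μ_{α,id_c} ∘ R_α(δ_c) = id`, up to the equality `α id_c = α`. -/
  id_left : ∀ {c d : C} (α : c ⟶ d) (a : obj c),
    (map α).map ((δ c).hom.app a) ≫ (μ (𝟙 c) α).hom.app a =
      eqToHom (by rw [Category.id_comp]; rfl)
  /-- `μ_{id_d,α} ∘ δ_d = id`, up to the equality `id_d α = α`. -/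
  id_right : ∀ {c d : C} (α : c ⟶ d) (a : obj c),
    (δ d).hom.app ((map α).obj a) ≫ (μ α (𝟙 d)).hom.app a =
      eqToHom (by rw [Category.comp_id]; rfl)

attribute [instance] Representation.category Representation.preadditive Representation.additive

variable {C}

/-- A representation is right flat if all the functors `R_α` are right flat. -/
def Representation.IsRightFlat (R : Representation C) : Prop :=
  ∀ {c d : C} (α : c ⟶ d), CartesianModules.IsRightFlat (R.map α)

/-- A right module `M` over a representation `R`. The two axioms are stated on elements
`x ∈ M_c(a)`. -/
structure RepModule (R : Representation C) where
  /-- The right `R_c`-module `M_c`. -/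
  obj : ∀ c : C, RightMod (R.obj c)
  /-- The structural morphism `M_α : M_c ⟶ α^* M_d`. -/
  map : ∀ {c d : C} (α : c ⟶ d), obj c ⟶ (restrictScalars (R.map α)).obj (obj d)
  /-- `α^*(M_β) ∘ M_α` is the composite of `M_{βα}` with the map `(βα)^* M_e ⟶ α^* β^* M_e`
  induced by `μ_{β,α}`. -/
  map_comp : ∀ {c d e : C} (α : c ⟶ d) (β : d ⟶ e) (a : R.obj c) (x : (obj c).obj.obj (op a)),
    (map β).hom.app (op ((R.map α).obj a)) ((map α).hom.app (op a) x) =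
      (obj e).obj.map ((R.μ α β).hom.app a).op ((map (α ≫ β)).hom.app (op a) x)
  /-- The composite of `M_{id_c}` with the map `(id_c)^* M_c ⟶ M_c` induced by `δ_c` is the
  identity. -/
  map_id : ∀ (c : C) (a : R.obj c) (x : (obj c).obj.obj (op a)),
    (obj c).obj.map ((R.δ c).hom.app a).op ((map (𝟙 c)).hom.app (op a) x) = x

namespace RepModule

variable {R : Representation C}

/-- A morphism of right modules over a representation. -/
@[ext]
structure Hom (M N : RepModule R) where
  /-- The component `φ_c : M_c ⟶ N_c`. -/
  app : ∀ c : C, M.obj c ⟶ N.obj c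
  naturality : ∀ {c d : C} (α : c ⟶ d),
    M.map α ≫ (restrictScalars (R.map α)).map (app d) = app c ≫ N.map α

/-- The category `Mod-R` of right modules over a representation `R`. -/
instance : Category.{u} (RepModule R) where
  Hom M N := Hom M N
  id M := ⟨fun c => 𝟙 (M.obj c), fun α => by
    rw [CategoryTheory.Functor.map_id, Category.id_comp, Category.comp_id]⟩
  comp f g := ⟨fun c => f.app c ≫ g.app c, fun α => by
    rw [CategoryTheory.Functor.map_comp, ← Category.assoc, f.naturality, Category.assoc,
      g.naturality, Category.assoc]⟩

/-- A module `M` is cartesian if, for every `α : c ⟶ d`, the morphism `α_!(M_c) ⟶ M_d` adjoint to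
the structural morphism `M_α : M_c ⟶ α^*(M_d)` is an isomorphism. -/
def isCartesian (R : Representation C) : ObjectProperty (RepModule R) := fun M =>
  ∀ ⦃c d : C⦄ (α : c ⟶ d),
    IsIso (((changeOfBase (R.map α)).homEquiv (M.obj c) (M.obj d)).symm (M.map α))

end RepModule

/-- The full subcategory `Mod_cart(R)` of cartesian modules. -/
abbrev ModCart (R : Representation C) : Type (u + 1) :=
  (RepModule.isCartesian R).FullSubcategory

end Representation

end CartesianModules

end

/-! Limits and colimits of modules over `R` are computed in each group `M_c(a)`: restriction of
scalars is a right adjoint, so structural morphisms pass to limits, and they pass to colimits by the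
universal property. The adjoint morphisms `α_!(M_c) ⟶ M_d` are natural in `M` (`mate`), and `M` is
cartesian when all of them are invertible. Since `α_!` preserves colimits, and finite limits by
flatness, cartesian modules are closed under colimits and finite limits. The functor `underlying` to
families of abelian groups therefore preserves both; it also reflects isomorphisms. Hence the
comparison of coimage with image is invertible, and filtered colimits are exact, because this is so
for abelian groups.

For the generator, every element `x` of a cartesian `M` is placed in a cartesian submodule of
bounded size. Each `y ∈ M_d(b)` comes from a finite sum of pure tensors in `α_!(M_c)(b)`, so it is
generated by countably many elements of the groups `M_c(a)` (`exists_witness`). Closing `x` under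
the module operations and under these witnesses gives a submodule `N`. Flatness keeps `α_!(N_c) ⟶
N_d` injective, and the witnesses make it surjective (`Sub.isCartesian_toModule`). Elements of `N`
are values of formal terms, and `N` is determined up to isomorphism by the relation "same value" on
terms. Such relations form a small set, so the modules they present form a small separating family,
and its coproduct is a generator. -/

noncomputable section

namespace CartesianModules

/-! ### Limits and colimits of additive functors -/

section AdditiveFunctors

universe w' w v₁ v₂ u₁ u₂

variable (A : Type u₁) [Category.{v₁} A] [Preadditive A]
  (B : Type u₂) [Category.{v₂} B] [Preadditive B] (J : Type w) [Category.{w'} J]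

/-- The projections of a limit of functors are jointly monic at each object, and after each
projection additivity is that of a functor in the diagram. -/
instance isClosedUnderLimitsOfShape_additiveFunctor [HasLimitsOfShape J B] :
    (additiveFunctor A B).IsClosedUnderLimitsOfShape J where
  limitsOfShape_le := by
    rintro F ⟨p⟩
    refine ⟨fun {X Y f g} => ?_⟩
    refine (isLimitOfPreserves ((evaluation A B).obj Y) p.isLimit).hom_ext fun j => ?_
    have : (p.diag.obj j).Additive := p.prop_diag_obj j
    change F.map (f + g) ≫ (p.π.app j).app Y = (F.map f + F.map g) ≫ (p.π.app j).app Y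
    rw [Preadditive.add_comp, NatTrans.naturality, NatTrans.naturality, NatTrans.naturality]
    exact (congrArg ((p.π.app j).app X ≫ ·) (p.diag.obj j).map_add).trans
      (Preadditive.comp_add _ _ _ _ _ _)

instance isClosedUnderColimitsOfShape_additiveFunctor [HasColimitsOfShape J B] :
    (additiveFunctor A B).IsClosedUnderColimitsOfShape J where
  colimitsOfShape_le := by
    rintro F ⟨p⟩
    refine ⟨fun {X Y f g} => ?_⟩
    refine (isColimitOfPreserves ((evaluation A B).obj X) p.isColimit).hom_ext fun j => ?_
    have : (p.diag.obj j).Additive := p.prop_diag_obj j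
    change (p.ι.app j).app X ≫ F.map (f + g) = (p.ι.app j).app X ≫ (F.map f + F.map g)
    have h (k : X ⟶ Y) : (p.ι.app j).app X ≫ F.map k = (p.diag.obj j).map k ≫ (p.ι.app j).app Y :=
      ((p.ι.app j).naturality k).symm
    rw [Preadditive.comp_add, h, h, h]
    exact (congrArg (· ≫ (p.ι.app j).app Y) (p.diag.obj j).map_add).trans
      (Preadditive.add_comp _ _ _ _ _ _)

end AdditiveFunctors

/-! ### Evaluation of right modules at an object -/

section Evaluation

variable {S : Type u} [Category.{u} S] [Preadditive S]

/-- Evaluation of right modules at an object. -/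
def evalAt (a : S) : RightMod S ⥤ AddCommGrpCat.{u} :=
  AdditiveFunctor.forget _ _ ⋙ (evaluation Sᵒᵖ AddCommGrpCat.{u}).obj (op a)

theorem isIso_of_isIso_evalAt {M N : RightMod S} (f : M ⟶ N)
    (h : ∀ a, IsIso ((evalAt a).map f)) : IsIso f := by
  have (a : Sᵒᵖ) : IsIso (f.hom.app a) := h a.unop
  have : IsIso ((AdditiveFunctor.forget _ _).map f) := NatIso.isIso_of_isIso_app f.hom
  exact isIso_of_reflects_iso f (AdditiveFunctor.forget _ _)

variable (a : S) {J : Type*} [Category* J]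

instance [HasLimitsOfShape J AddCommGrpCat.{u}] : PreservesLimitsOfShape J (evalAt a) := by
  unfold evalAt; infer_instance

instance [HasColimitsOfShape J AddCommGrpCat.{u}] : PreservesColimitsOfShape J (evalAt a) := by
  unfold evalAt; infer_instance

end Evaluation

/-! ### Componentwise description of modules over a representation -/

namespace RepModule

variable {C : Type u} [SmallCategory C] {R : Representation C}

@[simp] theorem id_app (M : RepModule R) (c : C) : Hom.app (𝟙 M) c = 𝟙 (M.obj c) := rfl

@[simp] theorem comp_app {M N P : RepModule R} (f : M ⟶ N) (g : N ⟶ P) (c : C) :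
    (f ≫ g).app c = f.app c ≫ g.app c := rfl

@[ext] theorem hom_ext {M N : RepModule R} {f g : M ⟶ N} (h : ∀ c, f.app c = g.app c) : f = g :=
  Hom.ext (funext h)

variable (R) in
/-- The functor `M ↦ M_c`. -/
@[simps] def component (c : C) : RepModule R ⥤ RightMod (R.obj c) where
  obj M := M.obj c
  map f := f.app c

/-- The inverses of the components commute with the structural morphisms automatically. -/
theorem isIso_of_isIso_app {M N : RepModule R} (f : M ⟶ N) (h : ∀ c, IsIso (f.app c)) :
    IsIso f :=
  ⟨⟨⟨fun c => inv (f.app c), fun α => by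
      rw [IsIso.eq_inv_comp, ← Category.assoc, ← f.naturality, Category.assoc,
        ← CategoryTheory.Functor.map_comp]
      simp⟩,
    by ext c : 1; simp, by ext c : 1; simp⟩⟩


/-! ### Componentwise colimits of modules -/

section Colimits

variable {J : Type*} [Category* J] (K : J ⥤ RepModule R)
  {t : ∀ c, Cocone (K ⋙ component R c)} (ht : ∀ c, IsColimit (t c))

/-- The coprojections of a componentwise cocone. -/
def inj (t : ∀ c, Cocone (K ⋙ component R c)) (j : J) (c : C) : (K.obj j).obj c ⟶ (t c).pt :=
  (t c).ι.app j

variable {K} in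
theorem map_inj (t : ∀ c, Cocone (K ⋙ component R c)) {i j : J} (f : i ⟶ j) (c : C) :
    (K.map f).app c ≫ inj K t j c = inj K t i c :=
  (t c).w f

/-- Morphisms out of a componentwise colimit. -/
def colimitDesc {c : C} {X : RightMod (R.obj c)} (g : ∀ j, (K.obj j).obj c ⟶ X)
    (hg : ∀ (i j : J) (f : i ⟶ j), (K.map f).app c ≫ g j = g i) : (t c).pt ⟶ X :=
  (ht c).desc ⟨X, { app := g, naturality := fun i j f => (hg i j f).trans (Category.comp_id _).symm }⟩

theorem inj_colimitDesc {c : C} {X : RightMod (R.obj c)} (g : ∀ j, (K.obj j).obj c ⟶ X)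
    (hg : ∀ (i j : J) (f : i ⟶ j), (K.map f).app c ≫ g j = g i) (j : J) :
    inj K t j c ≫ colimitDesc K ht g hg = g j :=
  (ht c).fac _ j

theorem colimit_hom_ext {t : ∀ c, Cocone (K ⋙ component R c)} (ht : ∀ c, IsColimit (t c)) {c : C}
    {X : RightMod (R.obj c)} {g h : (t c).pt ⟶ X} (w : ∀ j, inj K t j c ≫ g = inj K t j c ≫ h) :
    g = h :=
  (ht c).hom_ext w

/-- Evaluation preserves the colimit. This allows the module axioms, which are stated on elements,
to be checked on elements coming from the diagram. -/
theorem colimit_hom_ext_apply [HasColimitsOfShape J AddCommGrpCat.{u}]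
    {t : ∀ c, Cocone (K ⋙ component R c)} (ht : ∀ c, IsColimit (t c)) {c : C}
    {a : R.obj c} {X : AddCommGrpCat.{u}} {g h : (t c).pt.obj.obj (op a) ⟶ X}
    (w : ∀ (j : J) (x : ((K.obj j).obj c).obj.obj (op a)),
      g ((inj K t j c).hom.app (op a) x) = h ((inj K t j c).hom.app (op a) x)) : g = h :=
  (isColimitOfPreserves (evalAt a) (ht c)).hom_ext fun j => by
    ext x
    exact w j x

/-- The structural morphisms of a componentwise colimit of modules. -/
def colimitMap {c d : C} (α : c ⟶ d) : (t c).pt ⟶ (restrictScalars (R.map α)).obj (t d).pt :=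
  colimitDesc K ht (fun j => (K.obj j).map α ≫ (restrictScalars (R.map α)).map (inj K t j d))
    fun i j f => by
      rw [← Category.assoc, ← (K.map f).naturality, Category.assoc,
        ← CategoryTheory.Functor.map_comp, map_inj]

theorem inj_colimitMap {c d : C} (α : c ⟶ d) (j : J) :
    inj K t j c ≫ colimitMap K ht α =
      (K.obj j).map α ≫ (restrictScalars (R.map α)).map (inj K t j d) :=
  inj_colimitDesc K ht _ _ j

theorem colimitMap_apply {c d : C} (α : c ⟶ d) (j : J) (a : R.obj c)
    (x : ((K.obj j).obj c).obj.obj (op a)) :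
    (colimitMap K ht α).hom.app (op a) ((inj K t j c).hom.app (op a) x) =
      (inj K t j d).hom.app (op ((R.map α).obj a)) (((K.obj j).map α).hom.app (op a) x) :=
  congrArg (fun g => g.hom.app (op a) x) (inj_colimitMap K ht α j)

/-- The components of the morphism from the componentwise colimit to the point of a cocone. -/
def colimitObjDescApp (s : Cocone K) (c : C) : (t c).pt ⟶ s.pt.obj c :=
  (ht c).desc ((component R c).mapCocone s)

theorem inj_colimitObjDescApp (s : Cocone K) (c : C) (j : J) :
    inj K t j c ≫ colimitObjDescApp K ht s c = (s.ι.app j).app c :=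
  (ht c).fac ((component R c).mapCocone s) j

variable [HasColimitsOfShape J AddCommGrpCat.{u}]

/-- The componentwise colimit of a diagram of modules. -/
def colimitObj : RepModule R where
  obj c := (t c).pt
  map α := colimitMap K ht α
  map_comp {c d e} α β a x := by
    have : (colimitMap K ht α).hom.app (op a) ≫
        (colimitMap K ht β).hom.app (op ((R.map α).obj a)) =
        (colimitMap K ht (α ≫ β)).hom.app (op a) ≫
          (t e).pt.obj.map ((R.μ α β).hom.app a).op := by
      refine colimit_hom_ext_apply K ht fun j x => ?_
      refine (congrArg _ (colimitMap_apply K ht α j a x)).trans ?_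
      refine (colimitMap_apply K ht β j _ _).trans ?_
      refine Eq.trans ?_ (congrArg _ (colimitMap_apply K ht (α ≫ β) j a x)).symm
      rw [(K.obj j).map_comp]
      exact NatTrans.naturality_apply (inj K t j e).hom ((R.μ α β).hom.app a).op _
    exact ConcreteCategory.congr_hom this x
  map_id c a x := by
    have : (colimitMap K ht (𝟙 c)).hom.app (op a) ≫ (t c).pt.obj.map ((R.δ c).hom.app a).op =
        𝟙 _ := by
      refine colimit_hom_ext_apply K ht fun j x => ?_
      refine (congrArg _ (colimitMap_apply K ht (𝟙 c) j a x)).trans ?_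
      refine (NatTrans.naturality_apply (inj K t j c).hom ((R.δ c).hom.app a).op _).symm.trans ?_
      exact congrArg _ ((K.obj j).map_id c a x)
    exact ConcreteCategory.congr_hom this x

/-- The componentwise colimit cocone. -/
def colimitCocone : Cocone K where
  pt := colimitObj K ht
  ι :=
    { app := fun j => ⟨fun c => inj K t j c, fun α => (inj_colimitMap K ht α j).symm⟩
      naturality := fun i j f => by
        ext c : 1
        exact (map_inj t f c).trans (Category.comp_id _).symm }

/-- The morphism from the componentwise colimit to the point of a cocone. -/
def colimitObjDesc (s : Cocone K) : colimitObj K ht ⟶ s.pt where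
  app c := colimitObjDescApp K ht s c
  naturality {c d} α := by
    refine colimit_hom_ext K ht fun j => ?_
    change inj K t j c ≫ colimitMap K ht α ≫ (restrictScalars (R.map α)).map
      (colimitObjDescApp K ht s d) = inj K t j c ≫ colimitObjDescApp K ht s c ≫ s.pt.map α
    rw [← Category.assoc, inj_colimitMap, Category.assoc, ← CategoryTheory.Functor.map_comp,
      inj_colimitObjDescApp, ← Category.assoc, inj_colimitObjDescApp]
    exact (s.ι.app j).naturality α

/-- The componentwise colimit cocone is a colimit cocone. -/
def isColimitColimitCocone : IsColimit (colimitCocone K ht) where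
  desc s := colimitObjDesc K ht s
  fac s j := by
    ext c : 1
    exact inj_colimitObjDescApp K ht s c j
  uniq s m hm := by
    ext c : 1
    exact (ht c).uniq ((component R c).mapCocone s) _ fun j =>
      congrArg (fun g : K.obj j ⟶ s.pt => g.app c) (hm j)

end Colimits

section

variable (J : Type*) [Category* J] [HasColimitsOfShape J AddCommGrpCat.{u}]

instance : HasColimitsOfShape J (RepModule R) where
  has_colimit K := ⟨⟨_, isColimitColimitCocone K fun _ => colimit.isColimit _⟩⟩

instance (c : C) : PreservesColimitsOfShape J (component R c) where
  preservesColimit {K} := preservesColimit_of_preserves_colimit_cocone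
    (isColimitColimitCocone K fun c => colimit.isColimit (K ⋙ component R c))
    (colimit.isColimit (K ⋙ component R c))

end

/-! ### Componentwise limits of modules -/

section Limits

variable {J : Type*} [Category* J] (K : J ⥤ RepModule R)
  {t : ∀ c, Cone (K ⋙ component R c)} (ht : ∀ c, IsLimit (t c))

/-- The projections of a componentwise cone. -/
def proj (t : ∀ c, Cone (K ⋙ component R c)) (j : J) (c : C) : (t c).pt ⟶ (K.obj j).obj c :=
  (t c).π.app j

variable {K} in
theorem proj_map (t : ∀ c, Cone (K ⋙ component R c)) {i j : J} (f : i ⟶ j) (c : C) :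
    proj K t i c ≫ (K.map f).app c = proj K t j c :=
  (t c).w f

/-- Morphisms into a restriction of a componentwise limit. -/
def limitLift {c d : C} (α : c ⟶ d) {X : RightMod (R.obj c)}
    (g : ∀ j, X ⟶ (restrictScalars (R.map α)).obj ((K.obj j).obj d))
    (hg : ∀ (i j : J) (f : i ⟶ j),
      g i ≫ (restrictScalars (R.map α)).map ((K.map f).app d) = g j) :
    X ⟶ (restrictScalars (R.map α)).obj (t d).pt :=
  -- Restriction of scalars is a right adjoint, so it carries the limit at `d` to a limit over
  -- `R_c`.
  have := (changeOfBase (R.map α)).rightAdjoint_preservesLimits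
  (isLimitOfPreserves (restrictScalars (R.map α)) (ht d)).lift
    ⟨X, { app := g, naturality := fun i j f => (Category.id_comp _).trans (hg i j f).symm }⟩

theorem limitLift_proj {c d : C} (α : c ⟶ d) {X : RightMod (R.obj c)}
    (g : ∀ j, X ⟶ (restrictScalars (R.map α)).obj ((K.obj j).obj d))
    (hg : ∀ (i j : J) (f : i ⟶ j),
      g i ≫ (restrictScalars (R.map α)).map ((K.map f).app d) = g j) (j : J) :
    limitLift K ht α g hg ≫ (restrictScalars (R.map α)).map (proj K t j d) = g j :=
  have := (changeOfBase (R.map α)).rightAdjoint_preservesLimits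
  (isLimitOfPreserves (restrictScalars (R.map α)) (ht d)).fac _ j

/-- The structural morphisms of a componentwise limit of modules. -/
def limitMap {c d : C} (α : c ⟶ d) : (t c).pt ⟶ (restrictScalars (R.map α)).obj (t d).pt :=
  limitLift K ht α (fun j => proj K t j c ≫ (K.obj j).map α) fun i j f => by
    rw [Category.assoc, (K.map f).naturality, ← Category.assoc, proj_map]

theorem limitMap_proj {c d : C} (α : c ⟶ d) (j : J) :
    limitMap K ht α ≫ (restrictScalars (R.map α)).map (proj K t j d) =
      proj K t j c ≫ (K.obj j).map α :=
  limitLift_proj K ht α _ _ j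

theorem limitMap_apply {c d : C} (α : c ⟶ d) (j : J) (a : R.obj c) (x : (t c).pt.obj.obj (op a)) :
    (proj K t j d).hom.app (op ((R.map α).obj a)) ((limitMap K ht α).hom.app (op a) x) =
      ((K.obj j).map α).hom.app (op a) ((proj K t j c).hom.app (op a) x) :=
  congrArg (fun g => g.hom.app (op a) x) (limitMap_proj K ht α j)

theorem limit_hom_ext {t : ∀ c, Cone (K ⋙ component R c)} (ht : ∀ c, IsLimit (t c)) {c d : C}
    (α : c ⟶ d) {X : RightMod (R.obj c)} {g h : X ⟶ (restrictScalars (R.map α)).obj (t d).pt}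
    (w : ∀ j, g ≫ (restrictScalars (R.map α)).map (proj K t j d) =
      h ≫ (restrictScalars (R.map α)).map (proj K t j d)) : g = h :=
  have := (changeOfBase (R.map α)).rightAdjoint_preservesLimits
  (isLimitOfPreserves (restrictScalars (R.map α)) (ht d)).hom_ext w

/-- The components of the morphism from the point of a cone to the componentwise limit. -/
def limitObjLiftApp (s : Cone K) (c : C) : s.pt.obj c ⟶ (t c).pt :=
  (ht c).lift ((component R c).mapCone s)

theorem limitObjLiftApp_proj (s : Cone K) (c : C) (j : J) :
    limitObjLiftApp K ht s c ≫ proj K t j c = (s.π.app j).app c :=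
  (ht c).fac ((component R c).mapCone s) j

variable [HasLimitsOfShape J AddCommGrpCat.{u}]

theorem limit_ext {t : ∀ c, Cone (K ⋙ component R c)} (ht : ∀ c, IsLimit (t c)) {c : C}
    {a : R.obj c} {x y : (t c).pt.obj.obj (op a)}
    (h : ∀ j, (proj K t j c).hom.app (op a) x = (proj K t j c).hom.app (op a) y) : x = y := by
  -- An element is encoded as a homomorphism from `ℤ`, lifted to the universe `u`, so that
  -- uniqueness of morphisms into a limit applies to elements.
  let f (z : (t c).pt.obj.obj (op a)) :
      AddCommGrpCat.of (ULift.{u} ℤ) ⟶ (evalAt a).obj (t c).pt :=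
    AddCommGrpCat.ofHom ((zmultiplesHom _ z).comp AddEquiv.ulift.toAddMonoidHom)
  have hf (z) : f z ⟨1⟩ = z := one_zsmul z
  have : f x = f y := by
    refine (isLimitOfPreserves (evalAt a) (ht c)).hom_ext fun j => ?_
    ext ⟨n⟩
    change (proj K t j c).hom.app (op a) (n • x) = (proj K t j c).hom.app (op a) (n • y)
    rw [map_zsmul, map_zsmul, h]
  rw [← hf x, this, hf]

/-- The componentwise limit of a diagram of modules. -/
def limitObj : RepModule R where
  obj c := (t c).pt
  map α := limitMap K ht α
  map_comp {c d e} α β a x := limit_ext K ht fun j => by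
    refine (limitMap_apply K ht β j _ _).trans ?_
    refine (congrArg _ (limitMap_apply K ht α j a x)).trans ?_
    refine ((K.obj j).map_comp α β a _).trans ?_
    rw [← limitMap_apply]
    exact (NatTrans.naturality_apply (proj K t j e).hom ((R.μ α β).hom.app a).op _).symm
  map_id c a x := limit_ext K ht fun j => by
    refine (NatTrans.naturality_apply (proj K t j c).hom ((R.δ c).hom.app a).op _).trans ?_
    refine Eq.trans ?_ ((K.obj j).map_id c a _)
    exact congrArg _ (limitMap_apply K ht (𝟙 c) j a x)

/-- The componentwise limit cone. -/
def limitCone : Cone K where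
  pt := limitObj K ht
  π :=
    { app := fun j => ⟨fun c => proj K t j c, fun α => limitMap_proj K ht α j⟩
      naturality := fun i j f => by
        ext c : 1
        exact (Category.id_comp _).trans (proj_map t f c).symm }

/-- The morphism from the point of a cone to the componentwise limit. -/
def limitObjLift (s : Cone K) : s.pt ⟶ limitObj K ht where
  app c := limitObjLiftApp K ht s c
  naturality {c d} α := by
    refine limit_hom_ext K ht α fun j => ?_
    change (s.pt.map α ≫ (restrictScalars (R.map α)).map (limitObjLiftApp K ht s d)) ≫
      (restrictScalars (R.map α)).map (proj K t j d) = (limitObjLiftApp K ht s c ≫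
        limitMap K ht α) ≫ (restrictScalars (R.map α)).map (proj K t j d)
    rw [Category.assoc, Category.assoc, limitMap_proj, ← CategoryTheory.Functor.map_comp,
      limitObjLiftApp_proj, ← Category.assoc, limitObjLiftApp_proj]
    exact (s.π.app j).naturality α

/-- The componentwise limit cone is a limit cone. -/
def isLimitLimitCone : IsLimit (limitCone K ht) where
  lift s := limitObjLift K ht s
  fac s j := by
    ext c : 1
    exact (ht c).fac ((component R c).mapCone s) j
  uniq s m hm := by
    ext c : 1
    exact (ht c).uniq ((component R c).mapCone s) _ fun j =>
      congrArg (fun g : s.pt ⟶ K.obj j => g.app c) (hm j)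

end Limits

section

variable (J : Type*) [Category* J] [HasLimitsOfShape J AddCommGrpCat.{u}]

instance : HasLimitsOfShape J (RepModule R) where
  has_limit K := ⟨⟨_, isLimitLimitCone K fun _ => limit.isLimit _⟩⟩

instance (c : C) : PreservesLimitsOfShape J (component R c) where
  preservesLimit {K} := preservesLimit_of_preserves_limit_cone
    (isLimitLimitCone K fun c => limit.isLimit (K ⋙ component R c))
    (limit.isLimit (K ⋙ component R c))

end

end RepModule

/-! ### Invertibility of natural transformations at limits and colimits -/

section

variable {A B J : Type*} [Category* A] [Category* B] [Category* J] {F G : A ⥤ B}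

/-- Both functors preserve the limit, so the component at the limit is the morphism induced by an
isomorphism of diagrams. -/
theorem isIso_app_of_isLimit (θ : F ⟶ G) {K : J ⥤ A} [PreservesLimit K F] [PreservesLimit K G]
    {t : Cone K} (ht : IsLimit t) (h : ∀ j, IsIso (θ.app (K.obj j))) : IsIso (θ.app t.pt) := by
  have (j : J) : IsIso ((Functor.whiskerLeft K θ).app j) := h j
  have : IsIso (Functor.whiskerLeft K θ) := NatIso.isIso_of_isIso_app _
  have e : θ.app t.pt = ((isLimitOfPreserves F ht).conePointsIsoOfNatIso
      (isLimitOfPreserves G ht) (asIso (Functor.whiskerLeft K θ))).hom :=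
    (isLimitOfPreserves G ht).hom_ext fun j =>
      (θ.naturality (t.π.app j)).symm.trans
        (IsLimit.map_π (F.mapCone t) (isLimitOfPreserves G ht) (Functor.whiskerLeft K θ) j).symm
  rw [e]
  infer_instance

theorem isIso_app_of_isColimit (θ : F ⟶ G) {K : J ⥤ A} [PreservesColimit K F]
    [PreservesColimit K G] {t : Cocone K} (ht : IsColimit t)
    (h : ∀ j, IsIso (θ.app (K.obj j))) : IsIso (θ.app t.pt) := by
  have (j : J) : IsIso ((Functor.whiskerLeft K θ).app j) := h j
  have : IsIso (Functor.whiskerLeft K θ) := NatIso.isIso_of_isIso_app _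
  have e : θ.app t.pt = ((isColimitOfPreserves F ht).coconePointsIsoOfNatIso
      (isColimitOfPreserves G ht) (asIso (Functor.whiskerLeft K θ))).hom :=
    (isColimitOfPreserves F ht).hom_ext fun j =>
      (θ.naturality (t.ι.app j)).trans
        (IsColimit.ι_map (isColimitOfPreserves F ht) (G.mapCocone t) (Functor.whiskerLeft K θ) j).symm
  rw [e]
  infer_instance

end

instance {R S : Type u} [Category.{u} R] [Preadditive R] [Category.{u} S] [Preadditive S]
    (φ : R ⥤ S) [φ.Additive] : (restrictScalars φ).Additive where
  map_add := rfl

instance {S : Type u} [Category.{u} S] [Preadditive S] (a : S) : (evalAt a).Additive where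
  map_add := rfl

theorem Representation.IsRightFlat.preservesFiniteLimits {C : Type u} [SmallCategory C]
    {R : Representation C} (hR : R.IsRightFlat) {c d : C} (α : c ⟶ d) :
    PreservesFiniteLimits (extendScalars (R.map α)) :=
  ((exactFunctor_iff _).1 (hR α)).1

/-! ### Closure properties of cartesian modules, and the additive structure -/

namespace RepModule

variable {C : Type u} [SmallCategory C] {R : Representation C}

variable (R) in
/-- The morphisms `α_!(M_c) ⟶ M_d` adjoint to the structural morphisms. -/
def mate {c d : C} (α : c ⟶ d) : component R c ⋙ extendScalars (R.map α) ⟶ component R d where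
  app M := ((changeOfBase (R.map α)).homEquiv (M.obj c) (M.obj d)).symm (M.map α)
  naturality M N f := by
    refine ((changeOfBase (R.map α)).homEquiv_naturality_left_symm (f.app c) (N.map α)).symm.trans
      (Eq.trans ?_ ((changeOfBase (R.map α)).homEquiv_naturality_right_symm (M.map α) (f.app d)))
    rw [f.naturality]

theorem isCartesian_iff (M : RepModule R) :
    isCartesian R M ↔ ∀ ⦃c d : C⦄ (α : c ⟶ d), IsIso ((mate R α).app M) :=
  Iff.rfl

/-- Both the source and the target of `mate R α` preserve colimits, the source because `α_!` is a
left adjoint. -/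
instance (J : Type*) [Category* J] [HasColimitsOfShape J AddCommGrpCat.{u}] :
    (isCartesian R).IsClosedUnderColimitsOfShape J where
  colimitsOfShape_le := by
    rintro M ⟨p⟩
    refine (isCartesian_iff M).2 fun c d α => ?_
    have := (changeOfBase (R.map α)).leftAdjoint_preservesColimits
    have h := isIso_app_of_isColimit (mate R α) p.isColimit fun j =>
      (isCartesian_iff _).1 (p.prop_diag_obj j) α
    exact h

/-- Flatness enters here: it makes the source of `mate R α` preserve finite limits. -/
theorem isClosedUnderLimitsOfShape_isCartesian (hR : R.IsRightFlat) (J : Type) [SmallCategory J]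
    [FinCategory J] : (isCartesian R).IsClosedUnderLimitsOfShape J where
  limitsOfShape_le := by
    rintro M ⟨p⟩
    refine (isCartesian_iff M).2 fun c d α => ?_
    have := hR.preservesFiniteLimits α
    have h := isIso_app_of_isLimit (mate R α) p.isLimit fun j =>
      (isCartesian_iff _).1 (p.prop_diag_obj j) α
    exact h

section Preadditive

variable {M N : RepModule R}

instance : Zero (M ⟶ N) :=
  ⟨⟨fun _ => 0, fun α => by rw [CategoryTheory.Functor.map_zero, comp_zero, zero_comp]⟩⟩

instance : Add (M ⟶ N) :=
  ⟨fun f g => ⟨fun c => f.app c + g.app c, fun α => by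
    rw [CategoryTheory.Functor.map_add, Preadditive.comp_add, Preadditive.add_comp, f.naturality,
      g.naturality]⟩⟩

instance : Neg (M ⟶ N) :=
  ⟨fun f => ⟨fun c => -f.app c, fun α => by
    rw [CategoryTheory.Functor.map_neg, Preadditive.comp_neg, Preadditive.neg_comp,
      f.naturality]⟩⟩

instance : AddCommGroup (M ⟶ N) where
  add_assoc f g h := by ext c : 1; exact add_assoc _ _ _
  zero_add f := by ext c : 1; exact zero_add _
  add_zero f := by ext c : 1; exact add_zero _
  add_comm f g := by ext c : 1; exact add_comm _ _
  neg_add_cancel f := by ext c : 1; exact neg_add_cancel _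
  nsmul := nsmulRec
  zsmul := zsmulRec

instance : Preadditive (RepModule R) where
  add_comp _ _ _ f g h := by ext c : 1; exact Preadditive.add_comp _ _ _ _ _ _
  comp_add _ _ _ f g h := by ext c : 1; exact Preadditive.comp_add _ _ _ _ _ _

end Preadditive

end RepModule

/-! ### The abelian structure and exactness of filtered colimits -/

namespace ModCart

open RepModule

variable {C : Type u} [SmallCategory C] (R : Representation C)

/-- The functor `M ↦ M_c(a)` on cartesian modules. -/
def evalFunctor (c : C) (a : R.obj c) : ModCart R ⥤ AddCommGrpCat.{u} :=
  (isCartesian R).ι ⋙ component R c ⋙ evalAt a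

/-- The functor that sends a cartesian module to the family of its groups `M_c(a)`. -/
def underlying : ModCart R ⥤ Discrete (Σ c, R.obj c) ⥤ AddCommGrpCat.{u} where
  obj M := Discrete.functor fun p => (evalFunctor R p.1 p.2).obj M
  map f := Discrete.natTrans fun p => (evalFunctor R p.as.1 p.as.2).map f

instance : (underlying R).ReflectsIsomorphisms where
  reflects {M N} f hf := by
    have h₁ (c : C) (a : R.obj c) : IsIso ((evalAt a).map (f.hom.app c)) :=
      inferInstanceAs (IsIso (((underlying R).map f).app ⟨c, a⟩))
    have : IsIso ((isCartesian R).ι.map f) :=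
      isIso_of_isIso_app f.hom fun c => isIso_of_isIso_evalAt _ (h₁ c)
    exact (isCartesian R).fullyFaithfulι.isIso_of_isIso_map f

instance (J : Type*) [Category* J] [HasColimitsOfShape J AddCommGrpCat.{u}] :
    PreservesColimitsOfShape J (underlying R) :=
  preservesColimitsOfShape_of_evaluation _ _ fun p =>
    inferInstanceAs (PreservesColimitsOfShape J
      ((isCartesian R).ι ⋙ component R p.as.1 ⋙ evalAt p.as.2))

variable {R}

theorem preservesFiniteLimits_underlying (hR : R.IsRightFlat) :
    PreservesFiniteLimits (underlying R) where
  preservesFiniteLimits J _ _ :=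
    have := isClosedUnderLimitsOfShape_isCartesian hR J
    preservesLimitsOfShape_of_evaluation _ _ fun p =>
      inferInstanceAs (PreservesLimitsOfShape J
        ((isCartesian R).ι ⋙ component R p.as.1 ⋙ evalAt p.as.2))

theorem hasFiniteLimits (hR : R.IsRightFlat) : HasFiniteLimits (ModCart R) where
  out J _ _ :=
    have := isClosedUnderLimitsOfShape_isCartesian hR J
    inferInstance

instance : HasColimitsOfSize.{u, u} (ModCart R) where
  has_colimits_of_shape _ _ := inferInstance

instance : (underlying R).Additive where
  map_add := rfl

/-- The category of cartesian modules over a right flat representation is abelian. -/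
@[reducible]
def abelian (hR : R.IsRightFlat) : Abelian (ModCart R) :=
  have := hasFiniteLimits hR
  have := preservesFiniteLimits_underlying hR
  have := hasColimitsOfSizeShrink.{0, 0, u, u} (ModCart R)
  have {M N : ModCart R} (f : M ⟶ N) : IsIso (Abelian.coimageImageComparison f) := by
    -- `underlying R` preserves kernels and cokernels, so it carries the comparison morphism, up to
    -- isomorphism, to the one for families of abelian groups, which is invertible.
    have := IsIso.of_isIso_fac_right (Abelian.PreservesCoimage.hom_coimageImageComparison
      (underlying R) f).symm
    exact isIso_of_reflects_iso _ (underlying R)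
  Abelian.ofCoimageImageComparisonIsIso

/-- A functor that preserves the colimits in question and preserves and reflects finite limits
transfers exactness from its target, here families of abelian groups. -/
theorem ab5 (hR : R.IsRightFlat) : AB5OfSize.{u, u} (ModCart R) where
  ofShape J _ _ :=
    have := hasFiniteLimits hR
    have := preservesFiniteLimits_underlying hR
    have := reflectsFiniteLimits_of_reflectsIsomorphisms (F := underlying R)
    HasExactColimitsOfShape.domain_of_functor J (underlying R)

end ModCart

/-! ### Generation of the elements of cartesian modules -/

theorem closure_etmul {R S : Type u} [Category.{u} R] [Preadditive R] [Category.{u} S]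
    [Preadditive S] (φ : R ⥤ S) [φ.Additive] (M : RightMod R) (b : Sᵒᵖ) :
    AddSubgroup.closure {z : (extendObj φ M).obj b | ∃ (a : R) (x : M.obj.obj (op a))
      (f : b.unop ⟶ φ.obj a), etmul φ x f = z} = ⊤ := by
  set H := AddSubgroup.closure {z : (extendObj φ M).obj b | ∃ (a : R) (x : M.obj.obj (op a))
      (f : b.unop ⟶ φ.obj a), etmul φ x f = z}
  -- The projection onto the quotient by `H` kills all pure tensors, hence vanishes.
  have h : AddCommGrpCat.ofHom (QuotientAddGroup.mk' H) = 0 :=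
    extendObj_hom_ext fun a x f =>
      (QuotientAddGroup.eq_zero_iff _).2 (AddSubgroup.subset_closure ⟨a, x, f, rfl⟩)
  exact (AddSubgroup.eq_top_iff' _).2 fun z =>
    (QuotientAddGroup.eq_zero_iff z).1 (ConcreteCategory.congr_hom h z)

theorem rightMod_hom_ext {S : Type u} [Category.{u} S] [Preadditive S] {M N : RightMod S}
    {f g : M ⟶ N} (h : ∀ (a : S) (x : M.obj.obj (op a)), f.hom.app (op a) x = g.hom.app (op a) x) :
    f = g := by
  ext a x
  exact h a.unop x

namespace RepModule

variable {C : Type u} [SmallCategory C] {R : Representation C}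

theorem hom_ext_apply {M N : RepModule R} {f g : M ⟶ N}
    (h : ∀ (c : C) (a : R.obj c) (x : (M.obj c).obj.obj (op a)),
      (f.app c).hom.app (op a) x = (g.app c).hom.app (op a) x) : f = g :=
  hom_ext fun c => rightMod_hom_ext (h c)

theorem mate_etmul (M : RepModule R) {c d : C} (α : c ⟶ d) {a : R.obj c} {b : R.obj d}
    (x : (M.obj c).obj.obj (op a)) (f : b ⟶ (R.map α).obj a) :
    ((mate R α).app M).hom.app (op b) (etmul (R.map α) (b := op b) x f) =
      (M.obj d).obj.map f.op ((M.map α).hom.app (op a) x) := by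
  have h : (mate R α).app M = (extendScalars (R.map α)).map (M.map α) ≫
    (changeOfBase (R.map α)).counit.app (M.obj d) :=
      (changeOfBase (R.map α)).homEquiv_counit _ _ _
  rw [h]
  refine (congrArg _ (extendScalars_map_etmul (M.map α) (b := op b) x f)).trans ?_
  exact counitAppApp_etmul (R.map α) (M.obj d) (op b) a ((M.map α).hom.app (op a) x) f

/-- The subgroup of `M_d(b)` generated by the elements `M_d(f)(M_α(x))`, where `x` runs over
the elements of given subsets of the groups `M_c(a)`. -/
def generated (M : RepModule R) {c d : C} (α : c ⟶ d)
    (X : ∀ a : R.obj c, Set ((M.obj c).obj.obj (op a))) (b : R.obj d) :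
    AddSubgroup ((M.obj d).obj.obj (op b)) :=
  AddSubgroup.closure {z | ∃ (a : R.obj c) (x : (M.obj c).obj.obj (op a))
    (f : b ⟶ (R.map α).obj a), x ∈ X a ∧ (M.obj d).obj.map f.op ((M.map α).hom.app (op a) x) = z}

theorem generated_mono (M : RepModule R) {c d : C} (α : c ⟶ d)
    {X Y : ∀ a : R.obj c, Set ((M.obj c).obj.obj (op a))} (h : ∀ a, X a ⊆ Y a) (b : R.obj d) :
    generated M α X b ≤ generated M α Y b :=
  AddSubgroup.closure_mono fun _ ⟨a, x, f, hx, hz⟩ => ⟨a, x, f, h a hx, hz⟩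

/-- The morphism `α_!(M_c) ⟶ M_d` is surjective at `b`, and by `mate_etmul` it sends pure tensors,
which generate its source, to the listed generators. -/
theorem generated_univ {M : RepModule R} (hM : isCartesian R M) {c d : C} (α : c ⟶ d)
    (b : R.obj d) : generated M α (fun _ => Set.univ) b = ⊤ := by
  have : IsIso ((mate R α).app M) := hM α
  have hs : Function.Surjective (((mate R α).app M).hom.app (op b)) := by
    have : IsIso ((evalAt b).map ((mate R α).app M)) := inferInstance
    exact ((AddCommGrpCat.epi_iff_surjective _).1
      (inferInstance : Epi ((evalAt b).map ((mate R α).app M))))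
  refine (AddSubgroup.eq_top_iff' _).2 fun y => ?_
  obtain ⟨t, rfl⟩ := hs y
  have ht := (closure_etmul (R.map α) (M.obj c) (op b)).ge (AddSubgroup.mem_top t)
  have hle : AddSubgroup.closure {z : (extendObj (R.map α) (M.obj c)).obj (op b) |
      ∃ (a : R.obj c) (x : (M.obj c).obj.obj (op a)) (f : b ⟶ (R.map α).obj a),
        etmul (R.map α) x f = z} ≤ (generated M α (fun _ => Set.univ) b).comap
      (((mate R α).app M).hom.app (op b)).hom := by
    refine (AddSubgroup.closure_le _).2 ?_
    rintro _ ⟨a, x, f, rfl⟩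
    exact AddSubgroup.subset_closure ⟨a, x, f, trivial, (mate_etmul M α x f).symm⟩
  exact hle ht

/-- In a cartesian module, every element of `M_d(b)` is generated by countably many elements of
each `M_c(a)`. -/
theorem exists_witness {M : RepModule R} (hM : isCartesian R M) {c d : C} (α : c ⟶ d)
    {b : R.obj d} (y : (M.obj d).obj.obj (op b)) :
    ∃ w : ∀ a : R.obj c, ℕ → (M.obj c).obj.obj (op a),
      y ∈ generated M α (fun a => Set.range (w a)) b := by
  classical
  have hy := (generated_univ hM α b).ge (AddSubgroup.mem_top y)
  induction hy using AddSubgroup.closure_induction with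
  | mem z hz =>
    obtain ⟨a, x, f, -, rfl⟩ := hz
    -- A single generator needs only the element `x` at the object `a`; the family is filled up with
    -- `0` at all other objects.
    exact ⟨fun a' _ => if h : a = a' then h ▸ x else 0,
      AddSubgroup.subset_closure ⟨a, x, f, ⟨0, by simp⟩, rfl⟩⟩
  | zero => exact ⟨fun _ _ => 0, zero_mem _⟩
  | add y z _ _ hy hz =>
    obtain ⟨v, hv⟩ := hy
    obtain ⟨w, hw⟩ := hz
    -- Both witness families are merged into one along `ℕ ⊕ ℕ ≃ ℕ`; indexing by `ℕ` keeps one index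
    -- type for all elements.
    refine ⟨fun a i => Sum.elim (v a) (w a) (Equiv.natSumNatEquivNat.symm i), add_mem
      (generated_mono M α (fun a => ?_) b hv) (generated_mono M α (fun a => ?_) b hw)⟩
    · rintro _ ⟨i, rfl⟩
      exact ⟨Equiv.natSumNatEquivNat (Sum.inl i), by simp⟩
    · rintro _ ⟨i, rfl⟩
      exact ⟨Equiv.natSumNatEquivNat (Sum.inr i), by simp⟩
  | neg y _ hy =>
    obtain ⟨v, hv⟩ := hy
    exact ⟨v, neg_mem hv⟩

/-! ### Submodules -/

/-- A submodule of a module over a representation. -/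
structure Sub (M : RepModule R) where
  /-- The subgroup of `M_c(a)`. -/
  carrier : ∀ (c : C) (a : R.obj c), AddSubgroup ((M.obj c).obj.obj (op a))
  act_mem : ∀ {c : C} {a b : R.obj c} (f : b ⟶ a) {x : (M.obj c).obj.obj (op a)},
    x ∈ carrier c a → (M.obj c).obj.map f.op x ∈ carrier c b
  map_mem : ∀ {c d : C} (α : c ⟶ d) {a : R.obj c} {x : (M.obj c).obj.obj (op a)},
    x ∈ carrier c a → (M.map α).hom.app (op a) x ∈ carrier d ((R.map α).obj a)

namespace Sub

variable {M : RepModule R} (N : Sub M)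

/-- The components of a submodule. -/
def objFunctor (c : C) : (R.obj c)ᵒᵖ ⥤ AddCommGrpCat.{u} where
  obj a := AddCommGrpCat.of (N.carrier c a.unop)
  map {a b} f := AddCommGrpCat.ofHom ((((M.obj c).obj.map f).hom.comp
    (N.carrier c a.unop).subtype).codRestrict (N.carrier c b.unop)
      fun x => N.act_mem f.unop x.2)
  map_id a := by
    ext x
    exact ConcreteCategory.congr_hom ((M.obj c).obj.map_id a) x.1
  map_comp f g := by
    ext x
    exact ConcreteCategory.congr_hom ((M.obj c).obj.map_comp f g) x.1

instance (c : C) : (N.objFunctor c).Additive where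
  map_add {a b f g} := by
    ext x
    exact Subtype.ext (ConcreteCategory.congr_hom ((M.obj c).obj.map_add (f := f) (g := g)) x.1)

/-- A submodule as a module. -/
def toModule : RepModule R where
  obj c := AdditiveFunctor.of (N.objFunctor c)
  map {c d} α := ObjectProperty.homMk
    { app := fun a => AddCommGrpCat.ofHom ((((M.map α).hom.app a).hom.comp
        (N.carrier c a.unop).subtype).codRestrict (N.carrier d ((R.map α).obj a.unop))
          fun x => N.map_mem α x.2)
      naturality := fun a b f => by
        ext x
        exact Subtype.ext (NatTrans.naturality_apply (M.map α).hom f x.1) }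
  map_comp α β a x := Subtype.ext (M.map_comp α β a x.1)
  map_id c a x := Subtype.ext (M.map_id c a x.1)

/-- The inclusion of a submodule. -/
def incl : N.toModule ⟶ M where
  app c := ObjectProperty.homMk
    { app := fun a => AddCommGrpCat.ofHom (N.carrier c a.unop).subtype
      naturality := fun _ _ _ => rfl }
  naturality _ := rfl

instance (c : C) : Mono (N.incl.app c) where
  right_cancellation _ _ h := rightMod_hom_ext fun a x =>
    Subtype.ext (congrArg (fun k => k.hom.app (op a) x) h)

/-- By naturality, `α_!(N_c) ⟶ N_d ⟶ M_d` equals `α_!(N_c) ⟶ α_!(M_c) ≅ M_d`. The latter is mono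
because `α_!` is left exact, which gives injectivity; `hN` gives surjectivity. -/
theorem isCartesian_toModule (hR : R.IsRightFlat) (hM : isCartesian R M)
    (hN : ∀ {c d : C} (α : c ⟶ d) (b : R.obj d),
      N.carrier d b ≤ generated M α (fun a => (N.carrier c a : Set _)) b) :
    isCartesian R N.toModule := by
  refine (isCartesian_iff _).2 fun c d α => isIso_of_isIso_evalAt _ fun b => ?_
  have : IsIso ((mate R α).app M) := hM α
  have := hR.preservesFiniteLimits α
  have hnat := (mate R α).naturality N.incl
  have : Mono ((mate R α).app N.toModule ≫ (component R d).map N.incl) := by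
    rw [← hnat]
    have : Mono ((component R c).map N.incl) := inferInstanceAs (Mono (N.incl.app c))
    exact mono_comp ((extendScalars (R.map α)).map ((component R c).map N.incl)) _
  have : Mono ((mate R α).app N.toModule) := mono_of_mono _ ((component R d).map N.incl)
  have : Mono ((evalAt b).map ((mate R α).app N.toModule)) := inferInstance
  have : Epi ((evalAt b).map ((mate R α).app N.toModule)) := by
    refine (AddCommGrpCat.epi_iff_surjective _).2 fun y => ?_
    -- Each generator is the image of a pure tensor `x ⊗ f` with `x` in the submodule, so the image
    -- in `M_d(b)` contains everything generated.
    have hle : generated M α (fun a => (N.carrier c a : Set _)) b ≤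
        ((N.carrier d b).subtype.comp
          (((mate R α).app N.toModule).hom.app (op b)).hom).range := by
      refine (AddSubgroup.closure_le _).2 ?_
      rintro _ ⟨a, x, f, hx, rfl⟩
      refine ⟨etmul (R.map α) (M := N.toModule.obj c) (b := op b) ⟨x, hx⟩ f, ?_⟩
      exact congrArg Subtype.val (mate_etmul N.toModule α ⟨x, hx⟩ f)
    obtain ⟨t, ht⟩ := hle (hN α b y.2)
    exact ⟨t, Subtype.ext ht⟩
  exact isIso_of_mono_of_epi _

end Sub

/-! ### Modules presented by terms -/

variable (R) in
/-- Formal expressions for elements of the groups `M_c(a)` in terms of one element of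
`M_{c₀}(a₀)`. -/
inductive Term (c₀ : C) (a₀ : R.obj c₀) : ∀ c : C, R.obj c → Type u
  | gen : Term c₀ a₀ c₀ a₀
  | zero (c : C) (a : R.obj c) : Term c₀ a₀ c a
  | add {c : C} {a : R.obj c} (s t : Term c₀ a₀ c a) : Term c₀ a₀ c a
  | neg {c : C} {a : R.obj c} (t : Term c₀ a₀ c a) : Term c₀ a₀ c a
  | act {c : C} {a b : R.obj c} (f : b ⟶ a) (t : Term c₀ a₀ c a) : Term c₀ a₀ c b
  | map {c d : C} (α : c ⟶ d) {a : R.obj c} (t : Term c₀ a₀ c a) : Term c₀ a₀ d ((R.map α).obj a)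
  | wit {c d : C} (α : c ⟶ d) {b : R.obj d} (t : Term c₀ a₀ d b) (a : R.obj c) (i : ℕ) :
      Term c₀ a₀ c a

/-- A surjective interpretation of terms in a module. -/
structure Presentation (c₀ : C) (a₀ : R.obj c₀) (N : RepModule R) where
  /-- The interpretation of terms. -/
  eval : ∀ {c : C} {a : R.obj c}, Term R c₀ a₀ c a → (N.obj c).obj.obj (op a)
  eval_surjective : ∀ {c : C} {a : R.obj c} (x : (N.obj c).obj.obj (op a)), ∃ t, eval t = x
  eval_add : ∀ {c : C} {a : R.obj c} (s t : Term R c₀ a₀ c a),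
    eval (s.add t) = eval s + eval t
  eval_act : ∀ {c : C} {a b : R.obj c} (f : b ⟶ a) (t : Term R c₀ a₀ c a),
    eval (t.act f) = (N.obj c).obj.map f.op (eval t)
  eval_map : ∀ {c d : C} (α : c ⟶ d) {a : R.obj c} (t : Term R c₀ a₀ c a),
    eval (t.map α) = (N.map α).hom.app (op a) (eval t)

namespace Presentation

variable {c₀ : C} {a₀ : R.obj c₀} {N N' : RepModule R}

/-- The relation that two terms have the same value. -/
def rel (P : Presentation c₀ a₀ N) (c : C) (a : R.obj c) (s t : Term R c₀ a₀ c a) : Prop :=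
  P.eval s = P.eval t

/-- The map between presented modules that preserves the values of terms. -/
def homFun (P : Presentation c₀ a₀ N) (P' : Presentation c₀ a₀ N') {c : C} {a : R.obj c}
    (x : (N.obj c).obj.obj (op a)) : (N'.obj c).obj.obj (op a) :=
  P'.eval (P.eval_surjective x).choose

/-- The term chosen in `homFun` and `t` agree under `P`, hence under `P'`, so the choice does not
matter. -/
theorem homFun_eval {P : Presentation c₀ a₀ N} {P' : Presentation c₀ a₀ N'} (h : P.rel = P'.rel)
    {c : C} {a : R.obj c} (t : Term R c₀ a₀ c a) : homFun P P' (P.eval t) = P'.eval t :=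
  (congrFun (congrFun (congrFun (congrFun h c) a) _) t).mp (P.eval_surjective (P.eval t)).choose_spec

/-- The morphism between presented modules that preserves the values of terms. -/
def hom {P : Presentation c₀ a₀ N} {P' : Presentation c₀ a₀ N'} (h : P.rel = P'.rel) :
    N ⟶ N' where
  app c := ObjectProperty.homMk
    { app := fun a => AddCommGrpCat.ofHom (AddMonoidHom.mk'
        (fun x => (homFun P P' (a := a.unop) x : (N'.obj c).obj.obj a)) fun x y => by
          obtain ⟨s, rfl⟩ := P.eval_surjective (a := a.unop) x
          obtain ⟨t, rfl⟩ := P.eval_surjective (a := a.unop) y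
          rw [homFun_eval h, homFun_eval h, ← P'.eval_add, ← homFun_eval h, P.eval_add])
      naturality := fun a b f => by
        ext x
        obtain ⟨t, rfl⟩ := P.eval_surjective (a := a.unop) x
        change homFun P P' ((N.obj c).obj.map f.unop.op (P.eval t)) =
          (N'.obj c).obj.map f.unop.op (homFun P P' (P.eval t))
        rw [← P.eval_act, homFun_eval h, homFun_eval h, P'.eval_act] }
  naturality {c d} α := rightMod_hom_ext fun a x => by
    obtain ⟨t, rfl⟩ := P.eval_surjective x
    change homFun P P' ((N.map α).hom.app (op a) (P.eval t)) =
      (N'.map α).hom.app (op a) (homFun P P' (P.eval t))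
    rw [← P.eval_map, homFun_eval h, homFun_eval h, P'.eval_map]

theorem hom_eval {P : Presentation c₀ a₀ N} {P' : Presentation c₀ a₀ N'} (h : P.rel = P'.rel)
    {c : C} {a : R.obj c} (t : Term R c₀ a₀ c a) :
    ((hom h).app c).hom.app (op a) (P.eval t) = P'.eval t :=
  homFun_eval h t

/-- Modules that are presented by the same relation are isomorphic. -/
def iso {P : Presentation c₀ a₀ N} {P' : Presentation c₀ a₀ N'} (h : P.rel = P'.rel) :
    N ≅ N' where
  hom := hom h
  inv := hom h.symm
  hom_inv_id := hom_ext_apply fun c a x => by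
    obtain ⟨t, rfl⟩ := P.eval_surjective x
    exact (congrArg _ (hom_eval h t)).trans (hom_eval h.symm t)
  inv_hom_id := hom_ext_apply fun c a x => by
    obtain ⟨t, rfl⟩ := P'.eval_surjective x
    exact (congrArg _ (hom_eval h.symm t)).trans (hom_eval h t)

end Presentation

section Span

variable {M : RepModule R} (hM : isCartesian R M) {c₀ : C} {a₀ : R.obj c₀}
  (x₀ : (M.obj c₀).obj.obj (op a₀))

/-- Chosen elements of `M_c(a)` that generate a given element of `M_d(b)`. -/
def witness {M : RepModule R} (hM : isCartesian R M) {c d : C} (α : c ⟶ d) {b : R.obj d}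
    (y : (M.obj d).obj.obj (op b)) (a : R.obj c) : ℕ → (M.obj c).obj.obj (op a) :=
  (exists_witness hM α y).choose a

/-- The value of a term in a cartesian module. -/
def interpret : ∀ {c : C} {a : R.obj c}, Term R c₀ a₀ c a → (M.obj c).obj.obj (op a)
  | _, _, .gen => x₀
  | _, _, .zero _ _ => 0
  | _, _, .add s t => interpret s + interpret t
  | _, _, .neg t => -interpret t
  | c, _, .act f t => (M.obj c).obj.map f.op (interpret t)
  | _, _, .map α t => (M.map α).hom.app _ (interpret t)
  | _, _, .wit α t a i => witness hM α (interpret t) a i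

/-- The cartesian submodule generated by an element. -/
def span : Sub M where
  carrier c a :=
    { carrier := Set.range (interpret hM x₀ (c := c) (a := a))
      zero_mem' := ⟨.zero c a, rfl⟩
      add_mem' := by rintro _ _ ⟨s, rfl⟩ ⟨t, rfl⟩; exact ⟨s.add t, rfl⟩
      neg_mem' := by rintro _ ⟨t, rfl⟩; exact ⟨t.neg, rfl⟩ }
  act_mem f := by rintro _ ⟨t, rfl⟩; exact ⟨t.act f, rfl⟩
  map_mem α := by rintro _ _ ⟨t, rfl⟩; exact ⟨t.map α, rfl⟩

theorem isCartesian_span (hR : R.IsRightFlat) : isCartesian R (span hM x₀).toModule := by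
  refine (span hM x₀).isCartesian_toModule hR hM fun {c d} α b => ?_
  rintro _ ⟨t, rfl⟩
  -- The chosen witnesses for the value of `t` are themselves values of the terms `wit α t a i`, so
  -- they lie in the span.
  refine generated_mono M α (fun a => ?_) b (exists_witness hM α (interpret hM x₀ t)).choose_spec
  rintro _ ⟨i, rfl⟩
  exact ⟨.wit α t a i, rfl⟩

/-- The presentation of the cartesian submodule generated by an element. -/
def spanPresentation : Presentation c₀ a₀ (span hM x₀).toModule where
  eval t := ⟨interpret hM x₀ t, t, rfl⟩
  eval_surjective := by rintro c a ⟨_, t, rfl⟩; exact ⟨t, rfl⟩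
  eval_add _ _ := rfl
  eval_act _ _ := rfl
  eval_map _ _ _ := rfl

end Span

end RepModule

/-! ### A small separating family and the generator -/

namespace ModCart

open RepModule

variable {C : Type u} [SmallCategory C] (R : Representation C)

/-- The relations on terms that present cartesian modules. -/
def PresentingRel : Type u :=
  Σ (c₀ : C) (a₀ : R.obj c₀), {r : ∀ (c : C) (a : R.obj c),
    Term R c₀ a₀ c a → Term R c₀ a₀ c a → Prop //
      ∃ (N : ModCart R) (P : Presentation c₀ a₀ N.obj), P.rel = r}

/-- The cartesian module presented by a relation. -/
def presented (i : PresentingRel R) : ModCart R :=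
  i.2.2.2.choose

variable {R}

/-- To compare two morphisms at an element `x`, it suffices to compare them on the cartesian span of
`x`, which is isomorphic to a member of the family. -/
theorem isSeparating_presented (hR : R.IsRightFlat) :
    ObjectProperty.IsSeparating (.ofObj (presented R)) := by
  intro M M' f g h
  refine ObjectProperty.hom_ext _ (hom_ext_apply fun c a x => ?_)
  let N : ModCart R := ⟨_, isCartesian_span M.property x hR⟩
  let i : PresentingRel R := ⟨c, a, _, N, spanPresentation M.property x, rfl⟩
  -- The module chosen for the relation `i` need not be `N`, but both are presented by `i`, hence
  -- isomorphic.
  obtain ⟨P, hP⟩ := i.2.2.2.choose_spec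
  let e : (presented R i).obj ⟶ N.obj := (Presentation.iso hP).hom
  have he : IsIso e := inferInstanceAs (IsIso (Presentation.iso hP).hom)
  have hi := congrArg (fun k => k.hom) (h (presented R i) (ObjectProperty.ofObj_apply _ i)
    (ObjectProperty.homMk (e ≫ (span M.property x).incl)))
  have hfg : (span M.property x).incl ≫ f.hom = (span M.property x).incl ≫ g.hom := by
    refine (cancel_epi e).1 ?_
    exact (Category.assoc _ _ _).symm.trans (hi.trans (Category.assoc _ _ _))
  -- The term `gen` has value `x`, so evaluation there recovers the two images of `x`.
  exact congrArg (fun k => (k.app c).hom.app (op a) ((spanPresentation M.property x).eval .gen)) hfg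

/-- Terms live in `Type u`, hence so does `PresentingRel R`, and the coproduct of the whole family
exists. -/
theorem hasSeparator (hR : R.IsRightFlat) : HasSeparator (ModCart R) :=
  ⟨_, (isSeparator_sigma _).2 (isSeparating_presented hR)⟩

end ModCart

end CartesianModules

end

theorem theorem3p23 {C : Type u} [SmallCategory C] (R : CartesianModules.Representation C)
    (hR : R.IsRightFlat) :
    ∃ _ : Abelian (CartesianModules.ModCart R),
      IsGrothendieckAbelian.{u} (CartesianModules.ModCart R) :=
  let _ := CartesianModules.ModCart.abelian hR
  ⟨_, { ab5OfSize := CartesianModules.ModCart.ab5 hR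
        hasSeparator := CartesianModules.ModCart.hasSeparator hR }⟩
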